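/- Let $\Gamma=\{z\in\mathbb C:|z|=1\}$ and let $C(\Gamma)$ be the set of continuous functions $\Gamma\to\mathbb C$. For $g\in C(\Gamma)$ and $n\in\mathbb Z$ put $\widehat g(n)=\frac1{2\pi}\int_{-\pi}^{\pi}g(e^{it})e^{-int}\,dt$. A weight on $\mathbb Z$ is a map $\omega:\mathbb Z\to[1,\infty)$ such that $\omega(m+n)\le\omega(m)\,\omega(n)$ for all $m,n\in\mathbb Z$. A function $g\in C(\Gamma)$ has $\omega$-absolutely convergent Fourier series ($\omega$-ACFS) if $\sum_{n\in\mathbb Z}|\widehat g(n)|\,\omega(n)<\infty$. **Theorem.** Let $\omega$ be a weight on $\mathbb Z$ and let $f\in C(\Gamma)$ have $\omega$-ACFS. (I) If $f(z)\neq0$ for all $z\in\Gamma$, then there exists a weight $\nu$ on $\mathbb Z$ such that: (a) $1/f$ has $\nu$-ACFS; (b) $\nu$ is non-constant if and only if $\omega$ is non-constant; (c) $\nu(n)\le\omega(n)$ for all $n\in\mathbb Z$. (II) Let $\varphi$ be a function holomorphic on a neighbourhood of the range of $f$. Then there exists a weight $\chi$ on $\mathbb Z$ such that: (a) $\varphi\circ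 f$ has $\chi$-ACFS; (b) $\chi$ is non-constant if and only if $\omega$ is non-constant; (c) $\chi(n)\le\omega(n)$ for all $n\in\mathbb Z$. -/

import Mathlib

/-- A weight on `ℤ`: a submultiplicative map `ω : ℤ → [1, ∞)`. -/
structure IsWeight (ω : ℤ → ℝ) : Prop where
  one_le : ∀ n, 1 ≤ ω n
  submul : ∀ m n, ω (m + n) ≤ ω m * ω n

/-- `ω` is a constant function. -/
def IsConstantWeight (ω : ℤ → ℝ) : Prop :=
  ∃ c : ℝ, ∀ n, ω n = c

/-- The `n`-th Fourier coefficient `(1 / 2π) ∫_{-π}^{π} g (e^{it}) e^{-int} dt` of a function `g` on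
the unit circle `Γ` of `ℂ`. It is the Fourier coefficient of the `2π`-periodic function
`t ↦ g (e^{it})`. -/
noncomputable def circleFourierCoeff (g : Circle → ℂ) (n : ℤ) : ℂ :=
  haveI : Fact (0 < 2 * Real.pi) := ⟨Real.two_pi_pos⟩
  fourierCoeff (fun t : AddCircle (2 * Real.pi) => g (AddCircle.toCircle t)) n

/-- `g` is a continuous function on the unit circle whose Fourier series is
`ω`-absolutely convergent: `∑ |ĝ(n)| ω(n) < ∞`. -/
structure HasACFS (ω : ℤ → ℝ) (g : Circle → ℂ) : Prop where
  continuous : Continuous g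
  summable : Summable fun n : ℤ => ‖circleFourierCoeff g n‖ * ω n

open MeasureTheory Metric Set AddCircle
open scoped ENNReal

-- One weight serves both parts: `1 + log ω`. It is submultiplicative because `log ω` is subadditive
-- and nonnegative, lies below `ω` because `log x ≤ x - 1`, and is constant exactly when `ω` is,
-- since `log` is injective on the positive reals. A weight grows at most exponentially, so `1 + log
-- ω` grows at most linearly and `∑ ν n * q ^ |n|` converges for every `0 < q < 1`.
--
-- For weights with that last property the Wiener–Lévy theorem holds
-- (`HasACFS.comp_of_subexponential`): functions holomorphic on an annulus around the circle have
-- finite Wiener norm. Write `f = p + e` with `p` a trigonometric polynomial and `e` small in norm,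
-- and sum the Taylor expansion `φ ∘ f = ∑ e ^ k * (φ⁽ᵏ⁾ / k!) ∘ p` in that norm. Part (I) is the
-- case `φ w = 1 / w` on `{0}ᶜ`.

local instance : Fact (0 < 2 * Real.pi) := ⟨Real.two_pi_pos⟩

/-! ### Fourier coefficients on the circle -/

theorem circleFourierCoeff_def (g : Circle → ℂ) (n : ℤ) :
    circleFourierCoeff g n =
      ∫ t : AddCircle (2 * Real.pi), fourier (-n) t * g (toCircle t) ∂haarAddCircle := rfl

theorem fourier_eq_coe_zpow {T : ℝ} (n : ℤ) (t : AddCircle T) :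
    fourier n t = (toCircle t : ℂ) ^ n := by
  rw [fourier_apply, toCircle_zsmul, Circle.coe_zpow]

theorem norm_fourier_apply {T : ℝ} (n : ℤ) (t : AddCircle T) : ‖fourier n t‖ = 1 :=
  Circle.norm_coe _

theorem integrable_fourier_mul {g : Circle → ℂ} (hg : Continuous g) (n : ℤ) :
    Integrable (fun t : AddCircle (2 * Real.pi) => fourier n t * g (toCircle t)) haarAddCircle :=
  ((map_continuous (fourier n)).mul (hg.comp continuous_toCircle)).integrable_of_hasCompactSupport
    (HasCompactSupport.of_compactSpace _)

/-- Fourier coefficients commute with normally convergent series. -/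
theorem hasSum_circleFourierCoeff {ι : Type*} [Countable ι] {g : ι → Circle → ℂ} {G : Circle → ℂ}
    {u : ι → ℝ} (hg : ∀ i, Continuous (g i)) (hu : Summable u) (hgu : ∀ i z, ‖g i z‖ ≤ u i)
    (hG : ∀ z, HasSum (fun i => g i z) (G z)) (n : ℤ) :
    HasSum (fun i => circleFourierCoeff (g i) n) (circleFourierCoeff G n) := by
  have key := hasSum_integral_of_summable_integral_norm (μ := haarAddCircle)
    (F := fun i (t : AddCircle (2 * Real.pi)) => fourier (-n) t * g i (toCircle t))
    (fun i => integrable_fourier_mul (hg i) _) ?_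
  · convert! key using 1
    rw [circleFourierCoeff_def]
    congr 1
    ext t
    rw [tsum_mul_left, (hG _).tsum_eq]
  · refine Summable.of_nonneg_of_le (fun i => integral_nonneg fun t => norm_nonneg _) (fun i => ?_) hu
    refine (integral_mono (integrable_fourier_mul (hg i) _).norm (integrable_const (u i))
      fun t => ?_).trans_eq ?_
    · simpa [norm_mul, norm_fourier_apply, -fourier_apply] using hgu i (toCircle t)
    · simp

theorem circleFourierCoeff_const_mul (c : ℂ) (g : Circle → ℂ) (n : ℤ) :
    circleFourierCoeff (fun z => c * g z) n = c * circleFourierCoeff g n := by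
  simp only [circleFourierCoeff_def, ← integral_const_mul]
  congr 1
  ext t
  ring

theorem circleFourierCoeff_zpow_mul (m : ℤ) (g : Circle → ℂ) (n : ℤ) :
    circleFourierCoeff (fun z => (z : ℂ) ^ m * g z) n = circleFourierCoeff g (n - m) := by
  simp only [circleFourierCoeff_def]
  congr 1
  ext t
  rw [← fourier_eq_coe_zpow, neg_sub, sub_eq_neg_add, fourier_add]
  ring

theorem circleFourierCoeff_one (n : ℤ) :
    circleFourierCoeff (fun _ => 1) n = if n = 0 then 1 else 0 := by
  have h := orthonormal_iff_ite.1 (orthonormal_fourier (T := 2 * Real.pi)) n 0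
  rw [ContinuousMap.inner_toLp (@haarAddCircle (2 * Real.pi) _) (fourier n) (fourier 0)] at h
  rw [← h, circleFourierCoeff_def]
  congr 1
  ext t
  rw [fourier_neg, fourier_zero]
  ring

/-- The Fourier series of a continuous function converges to it when the coefficients are
absolutely summable. -/
theorem hasSum_circleFourierCoeff_mul_zpow {g : Circle → ℂ} (hg : Continuous g)
    (hs : Summable fun n => ‖circleFourierCoeff g n‖) (z : Circle) :
    HasSum (fun n : ℤ => circleFourierCoeff g n * (z : ℂ) ^ n) (g z) := by
  obtain ⟨t, rfl⟩ : ∃ t : AddCircle (2 * Real.pi), toCircle t = z := by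
    refine ⟨(Complex.arg z : ℝ), ?_⟩
    rw [toCircle_apply_mk, div_self Real.two_pi_pos.ne', one_mul, Circle.exp_arg]
  have h := has_pointwise_sum_fourier_series_of_summable
    (f := ⟨fun t : AddCircle (2 * Real.pi) => g (toCircle t), hg.comp continuous_toCircle⟩)
    hs.of_norm t
  simpa only [← fourier_eq_coe_zpow] using! h

/-! ### Contour integrals and exponential decay of coefficients -/

/-- The Fourier coefficients of the restriction of `h` to the unit circle are contour integrals. -/
theorem circleFourierCoeff_eq_circleIntegral (h : ℂ → ℂ) (n : ℤ) :
    circleFourierCoeff (fun z => h z) n =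
      (2 * Real.pi * Complex.I : ℂ)⁻¹ • ∮ z in C(0, 1), (z - 0)⁻¹ • (z ^ (-n) * h z) := by
  have h1 : circleFourierCoeff (fun z => h z) n = _ := fourierCoeff_eq_intervalIntegral _ n 0
  rw [h1, circleIntegral, zero_add]
  have h2 : ∀ θ : ℝ, deriv (circleMap 0 1) θ • ((circleMap 0 1 θ - 0)⁻¹ •
      (circleMap 0 1 θ ^ (-n) * h (circleMap 0 1 θ))) =
      Complex.I * (fourier (-n) (θ : AddCircle (2 * Real.pi)) •
        h (toCircle (θ : AddCircle (2 * Real.pi)))) := by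
    intro θ
    have h3 : (toCircle (θ : AddCircle (2 * Real.pi)) : ℂ) = circleMap 0 1 θ := by
      rw [toCircle_apply_mk, div_self Real.two_pi_pos.ne', one_mul, Circle.coe_exp]
      simp [circleMap]
    have h4 : circleMap 0 1 θ ≠ 0 := circleMap_ne_center one_ne_zero
    rw [fourier_eq_coe_zpow, h3, deriv_circleMap, sub_zero]
    simp only [smul_eq_mul]
    field_simp
  simp_rw [h2]
  rw [intervalIntegral.integral_const_mul, Complex.real_smul]
  simp only [smul_eq_mul]
  have := Complex.I_ne_zero
  push_cast
  field_simp

/-- Cauchy's theorem moves the contour to radius `ρ⁻¹` for `n ≥ 0` and to radius `ρ` for `n ≤ 0`,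
where `z ^ (-n)` has modulus `ρ ^ |n|`. -/
theorem norm_circleFourierCoeff_le_of_annulus {h : ℂ → ℂ} {ρ B : ℝ} (hρ : 0 < ρ) (hρ1 : ρ ≤ 1)
    (hd : ∀ z : ℂ, ρ ≤ ‖z‖ → ‖z‖ ≤ ρ⁻¹ → DifferentiableAt ℂ h z)
    (hB : ∀ z : ℂ, ρ ≤ ‖z‖ → ‖z‖ ≤ ρ⁻¹ → ‖h z‖ ≤ B) (n : ℤ) :
    ‖circleFourierCoeff (fun z => h z) n‖ ≤ B * ρ ^ n.natAbs := by
  have hρ2 : 1 ≤ ρ⁻¹ := (one_le_inv₀ hρ).2 hρ1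
  have shift : ∀ r R : ℝ, ρ ≤ r → r ≤ R → R ≤ ρ⁻¹ →
      (∮ z in C(0, R), (z - 0)⁻¹ • (z ^ (-n) * h z)) =
        ∮ z in C(0, r), (z - 0)⁻¹ • (z ^ (-n) * h z) := by
    intro r R h1 h2 h3
    have hd' : ∀ z ∈ closedBall (0 : ℂ) R \ ball 0 r,
        DifferentiableAt ℂ (fun z => z ^ (-n) * h z) z := by
      intro z hz
      have hz1 : r ≤ ‖z‖ := by simpa using hz.2
      have hz2 : ‖z‖ ≤ R := by simpa using hz.1
      have hz0 : z ≠ 0 := norm_pos_iff.1 (hρ.trans_le (h1.trans hz1))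
      exact (differentiableAt_zpow.2 (Or.inl hz0)).mul (hd z (h1.trans hz1) (hz2.trans h3))
    refine Complex.circleIntegral_sub_center_inv_smul_eq_of_differentiable_on_annulus_off_countable
      (hρ.trans_le h1) h2 countable_empty
      (fun z hz => (hd' z hz).continuousAt.continuousWithinAt) fun z hz => hd' z ?_
    exact ⟨ball_subset_closedBall hz.1.1, fun h => hz.1.2 (ball_subset_closedBall h)⟩
  have bound : ∀ R : ℝ, ρ ≤ R → R ≤ ρ⁻¹ → ‖(2 * Real.pi * Complex.I : ℂ)⁻¹ •
      ∮ z in C(0, R), (z - 0)⁻¹ • (z ^ (-n) * h z)‖ ≤ B * R ^ (-n) := by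
    intro R h1 h2
    have hR : 0 < R := hρ.trans_le h1
    refine (circleIntegral.norm_two_pi_i_inv_smul_integral_le_of_norm_le_const hR.le
      (C := R⁻¹ * (R ^ (-n) * B)) fun z hz => ?_).trans_eq ?_
    · have hz : ‖z‖ = R := by simpa using hz
      rw [sub_zero, norm_smul, norm_mul, norm_inv, norm_zpow, hz]
      have := hB z (hz ▸ h1) (hz ▸ h2)
      gcongr
    · field_simp
  rw [circleFourierCoeff_eq_circleIntegral]
  rcases le_total 0 n with hn | hn
  · rw [← shift 1 ρ⁻¹ hρ1 hρ2 le_rfl]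
    convert! bound ρ⁻¹ (hρ1.trans hρ2) le_rfl using 2
    rw [inv_zpow', neg_neg, ← zpow_natCast, Int.natCast_natAbs, abs_of_nonneg hn]
  · rw [shift ρ 1 le_rfl hρ1 hρ2]
    convert! bound ρ le_rfl (hρ1.trans hρ2) using 2
    rw [← zpow_natCast, Int.natCast_natAbs, abs_of_nonpos hn]

/-! ### The weighted Wiener algebra -/

/-- The norm `∑ |ĝ(n)| ν(n)` of the weighted Wiener algebra, with value `∞` allowed. -/
noncomputable def wienerNorm (ν : ℤ → ℝ) (g : Circle → ℂ) : ℝ≥0∞ :=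
  ∑' n, ‖circleFourierCoeff g n‖ₑ * ENNReal.ofReal (ν n)

theorem enorm_mul_ofReal_eq (c : ℂ) {x : ℝ} : ‖c‖ₑ * ENNReal.ofReal x =
    ENNReal.ofReal (‖c‖ * x) := by
  rw [ENNReal.ofReal_mul (norm_nonneg _), ofReal_norm]

theorem hasACFS_of_wienerNorm_ne_top {ν : ℤ → ℝ} (hν : ∀ n, 0 ≤ ν n) {g : Circle → ℂ}
    (hg : Continuous g) (h : wienerNorm ν g ≠ ∞) : HasACFS ν g := by
  refine ⟨hg, ?_⟩
  convert! ENNReal.summable_toReal h using 2 with n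
  rw [enorm_mul_ofReal_eq, ENNReal.toReal_ofReal (mul_nonneg (norm_nonneg _) (hν n))]

theorem wienerNorm_const_mul (ν : ℤ → ℝ) (c : ℂ) (g : Circle → ℂ) :
    wienerNorm ν (fun z => c * g z) = ‖c‖ₑ * wienerNorm ν g := by
  simp only [wienerNorm, circleFourierCoeff_const_mul, enorm_mul, mul_assoc, ENNReal.tsum_mul_left]

theorem wienerNorm_zpow_mul_le {ν : ℤ → ℝ} (hν : IsWeight ν) (m : ℤ) (g : Circle → ℂ) :
    wienerNorm ν (fun z => (z : ℂ) ^ m * g z) ≤ ENNReal.ofReal (ν m) * wienerNorm ν g := by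
  simp only [wienerNorm, circleFourierCoeff_zpow_mul]
  rw [← (Equiv.addRight m).tsum_eq, ← ENNReal.tsum_mul_left]
  refine ENNReal.tsum_le_tsum fun n => ?_
  rw [Equiv.coe_addRight, add_sub_cancel_right, mul_left_comm,
    ← ENNReal.ofReal_mul (zero_le_one.trans (hν.one_le m))]
  gcongr
  exact (hν.submul n m).trans_eq (mul_comm _ _)

theorem circleFourierCoeff_zpow (m n : ℤ) :
    circleFourierCoeff (fun z => (z : ℂ) ^ m) n = if n = m then 1 else 0 := by
  have h := circleFourierCoeff_zpow_mul m (fun _ => 1) n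
  simpa [circleFourierCoeff_one, sub_eq_zero] using h

theorem wienerNorm_zpow (ν : ℤ → ℝ) (m : ℤ) :
    wienerNorm ν (fun z => (z : ℂ) ^ m) = ENNReal.ofReal (ν m) := by
  rw [wienerNorm, tsum_eq_single m fun n hn => by simp [circleFourierCoeff_zpow, hn]]
  simp [circleFourierCoeff_zpow]

/-- Countable subadditivity of the Wiener norm. -/
theorem wienerNorm_le_tsum (ν : ℤ → ℝ) {ι : Type*} [Countable ι] {g : ι → Circle → ℂ}
    {G : Circle → ℂ} {u : ι → ℝ} (hg : ∀ i, Continuous (g i)) (hu : Summable u)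
    (hgu : ∀ i z, ‖g i z‖ ≤ u i) (hG : ∀ z, HasSum (fun i => g i z) (G z)) :
    wienerNorm ν G ≤ ∑' i, wienerNorm ν (g i) := by
  simp only [wienerNorm]
  rw [ENNReal.tsum_comm]
  refine ENNReal.tsum_le_tsum fun n => ?_
  rw [ENNReal.tsum_mul_right, ← (hasSum_circleFourierCoeff hg hu hgu hG n).tsum_eq]
  gcongr
  exact enorm_tsum_le_tsum_enorm

theorem HasACFS.wienerNorm_ne_top {ν : ℤ → ℝ} {g : Circle → ℂ} (h : HasACFS ν g) :
    wienerNorm ν g ≠ ∞ := by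
  simp only [wienerNorm, enorm_mul_ofReal_eq]
  exact h.summable.tsum_ofReal_ne_top

theorem HasACFS.mono {ν ω : ℤ → ℝ} (hν : ∀ n, 0 ≤ ν n) (hνω : ∀ n, ν n ≤ ω n) {g : Circle → ℂ}
    (h : HasACFS ω g) : HasACFS ν g :=
  ⟨h.continuous, .of_nonneg_of_le (fun n => mul_nonneg (norm_nonneg _) (hν n))
    (fun n => mul_le_mul_of_nonneg_left (hνω n) (norm_nonneg _)) h.summable⟩

theorem HasACFS.summable_norm {ν : ℤ → ℝ} (hν : ∀ n, 1 ≤ ν n) {g : Circle → ℂ}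
    (h : HasACFS ν g) : Summable fun n => ‖circleFourierCoeff g n‖ :=
  .of_nonneg_of_le (fun _ => norm_nonneg _)
    (fun n => le_mul_of_one_le_right (norm_nonneg _) (hν n)) h.summable

/-- Submultiplicativity of the Wiener norm. -/
theorem wienerNorm_mul_le {ν : ℤ → ℝ} (hν : IsWeight ν) {g h : Circle → ℂ}
    (hg : HasACFS ν g) (hh : Continuous h) :
    wienerNorm ν (fun z => g z * h z) ≤ wienerNorm ν g * wienerNorm ν h := by
  have hs := hg.summable_norm hν.one_le
  obtain ⟨C, hC⟩ : ∃ C, ∀ z, ‖h z‖ ≤ C := by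
    obtain ⟨C, hC⟩ := (isCompact_range hh).isBounded.exists_norm_le
    exact ⟨C, fun z => hC _ (mem_range_self z)⟩
  -- Only `g` is expanded in its Fourier series; the norm of `h` may be infinite, so products can be
  -- iterated without first proving finiteness.
  calc wienerNorm ν (fun z => g z * h z)
      ≤ ∑' m : ℤ, wienerNorm ν (fun z => circleFourierCoeff g m * ((z : ℂ) ^ m * h z)) := by
        refine wienerNorm_le_tsum ν (u := fun m => ‖circleFourierCoeff g m‖ * C)
          (fun m => ?_) (hs.mul_right C) (fun m z => ?_) fun z => ?_
        · exact continuous_const.mul ((continuous_subtype_val.zpow₀ m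
            fun z => Or.inl (Circle.coe_ne_zero z)).mul hh)
        · rw [norm_mul, norm_mul, norm_zpow, Circle.norm_coe, one_zpow, one_mul]
          gcongr
          exact hC z
        · simpa only [mul_assoc] using
            (hasSum_circleFourierCoeff_mul_zpow hg.continuous hs z).mul_right (h z)
    _ ≤ ∑' m : ℤ, ‖circleFourierCoeff g m‖ₑ * ENNReal.ofReal (ν m) * wienerNorm ν h := by
        refine ENNReal.tsum_le_tsum fun m => ?_
        rw [wienerNorm_const_mul, mul_assoc]
        gcongr
        exact wienerNorm_zpow_mul_le hν m h
    _ = wienerNorm ν g * wienerNorm ν h := ENNReal.tsum_mul_right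

theorem wienerNorm_pow_mul_le {ν : ℤ → ℝ} (hν : IsWeight ν) {g h : Circle → ℂ}
    (hg : HasACFS ν g) (hh : Continuous h) (k : ℕ) :
    wienerNorm ν (fun z => g z ^ k * h z) ≤ wienerNorm ν g ^ k * wienerNorm ν h := by
  induction k with
  | zero => simp
  | succ k ih =>
    simp only [pow_succ', mul_assoc]
    refine (wienerNorm_mul_le hν hg ((hg.continuous.pow k).mul hh)).trans ?_
    exact mul_le_mul_right ih _

theorem enorm_le_wienerNorm {ν : ℤ → ℝ} (hν : ∀ n, 1 ≤ ν n) {g : Circle → ℂ}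
    (hg : HasACFS ν g) (z : Circle) : ‖g z‖ₑ ≤ wienerNorm ν g := by
  rw [← (hasSum_circleFourierCoeff_mul_zpow hg.continuous (hg.summable_norm hν) z).tsum_eq]
  refine enorm_tsum_le_tsum_enorm.trans (ENNReal.tsum_le_tsum fun n => ?_)
  rw [enorm_mul, ← ofReal_norm ((z : ℂ) ^ n), norm_zpow, Circle.norm_coe, one_zpow]
  gcongr
  exact hν n

/-- The partial sums of the Fourier series approximate in the Wiener norm. -/
theorem exists_wienerNorm_sub_le {ν : ℤ → ℝ} (hν : IsWeight ν) {g : Circle → ℂ}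
    (hg : HasACFS ν g) {ε : ℝ} (hε : 0 < ε) :
    ∃ s : Finset ℤ, wienerNorm ν
      (fun z => g z - ∑ n ∈ s, circleFourierCoeff g n * (z : ℂ) ^ n) ≤ ENNReal.ofReal ε := by
  have htop := hg.wienerNorm_ne_top
  have hs := hg.summable_norm hν.one_le
  obtain ⟨s, hsε⟩ := ((ENNReal.tendsto_tsum_compl_atTop_zero htop).eventually
    (ge_mem_nhds (ENNReal.ofReal_pos.2 hε))).exists
  refine ⟨s, le_trans ?_ hsε⟩
  refine (wienerNorm_le_tsum ν (ι := {n // n ∉ s})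
    (g := fun n z => circleFourierCoeff g n * (z : ℂ) ^ (n : ℤ))
    (u := fun n => ‖circleFourierCoeff g n‖) (fun n => ?_) (hs.subtype _) (fun n z => ?_)
    fun z => ?_).trans_eq ?_
  · exact continuous_const.mul (continuous_subtype_val.zpow₀ _
      fun z => Or.inl (Circle.coe_ne_zero z))
  · rw [norm_mul, norm_zpow, Circle.norm_coe, one_zpow, mul_one]
  · have h := hasSum_circleFourierCoeff_mul_zpow hg.continuous hs z
    refine (s.hasSum_compl_iff (f := fun n => circleFourierCoeff g n * (z : ℂ) ^ n)).2 ?_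
    rwa [sub_add_cancel]
  · simp only [wienerNorm_const_mul, wienerNorm_zpow]

/-! ### The Wiener–Lévy theorem -/

theorem exists_annulus_subset {V : Set ℂ} (hV : IsOpen V) (h : sphere (0 : ℂ) 1 ⊆ V) :
    ∃ ρ : ℝ, 0 < ρ ∧ ρ < 1 ∧ ∀ z : ℂ, ρ ≤ ‖z‖ → ‖z‖ ≤ ρ⁻¹ → z ∈ V := by
  obtain ⟨δ, hδ, hδV⟩ := (isCompact_sphere (0 : ℂ) 1).exists_thickening_subset_open hV h
  -- With `ρ = (1 + δ / 2)⁻¹ ≥ 1 - δ / 2`, each point of the annulus is within `δ / 2` of its radial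
  -- projection to the circle.
  have hρ : 0 < 1 + δ / 2 := by positivity
  refine ⟨(1 + δ / 2)⁻¹, by positivity, inv_lt_one_of_one_lt₀ (by linarith), fun z h1 h2 => ?_⟩
  rw [inv_inv] at h2
  have hz : 0 < ‖z‖ := (inv_pos.2 hρ).trans_le h1
  refine hδV (mem_thickening_iff.2 ⟨(‖z‖⁻¹ : ℝ) • z, ?_, ?_⟩)
  · simp [hz.ne']
  · have h3 : z - (‖z‖⁻¹ : ℝ) • z = (1 - ‖z‖⁻¹ : ℝ) • z := by rw [sub_smul, one_smul]
    have h4 : 1 - δ / 2 ≤ (1 + δ / 2)⁻¹ := by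
      rw [← one_div, le_div_iff₀ hρ]
      nlinarith
    rw [dist_eq_norm, h3, norm_smul, Real.norm_eq_abs, ← abs_of_pos hz, ← abs_mul,
      abs_of_pos hz, sub_mul, inv_mul_cancel₀ hz.ne', abs_lt]
    constructor <;> linarith

/-- **Wiener–Lévy theorem** for weights of subexponential growth. -/
theorem HasACFS.comp_of_subexponential {ν : ℤ → ℝ} (hν : IsWeight ν)
    (hsub : ∀ q : ℝ, 0 < q → q < 1 → Summable fun n : ℤ => ν n * q ^ n.natAbs)
    {f : Circle → ℂ} (hf : HasACFS ν f) {U : Set ℂ} {φ : ℂ → ℂ} (hU : IsOpen U)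
    (hfU : range f ⊆ U) (hφ : DifferentiableOn ℂ φ U) : HasACFS ν (φ ∘ f) := by
  have hν0 : ∀ n, 0 ≤ ν n := fun n => zero_le_one.trans (hν.one_le n)
  have hcont : Continuous (φ ∘ f) :=
    hφ.continuousOn.comp_continuous hf.continuous fun z => hfU (mem_range_self z)
  have hK : IsCompact (range f) := isCompact_range hf.continuous
  obtain ⟨δ, hδ, hδU⟩ := hK.exists_cthickening_subset_open hU hfU
  obtain ⟨M, hM⟩ := hK.cthickening.exists_bound_of_continuousOn (hφ.continuousOn.mono hδU)
  -- Values of `p` stay within `2r` of the range of `f`, and discs of radius `2r` about them stay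
  -- within `4r`, where `φ` is bounded by `M`. As `‖e‖ ≤ r` is half the Cauchy radius, the Taylor
  -- series has ratio `1 / 2`.
  obtain ⟨r, hr, rfl⟩ : ∃ r, 0 < r ∧ 4 * r = δ := ⟨δ / 4, by positivity, by ring⟩
  have hball : ∀ w ∈ thickening (2 * r) (range f),
      closedBall w (2 * r) ⊆ cthickening (4 * r) (range f) := by
    intro w hw y hy
    obtain ⟨x, hx, hwx⟩ := mem_thickening_iff.1 hw
    refine mem_cthickening_of_dist_le y x _ _ hx ((dist_triangle y w x).trans ?_)
    have := mem_closedBall.1 hy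
    linarith
  have hM0 : 0 ≤ M := (norm_nonneg _).trans
    (hM (f 1) (self_subset_cthickening _ (mem_range_self 1)))
  let a : ℕ → ℂ → ℂ := fun k w => (k.factorial : ℂ)⁻¹ * iteratedDeriv k φ w
  have ha_bound : ∀ k, ∀ w ∈ thickening (2 * r) (range f), ‖a k w‖ ≤ M / (2 * r) ^ k := by
    intro k w hw
    have h := Complex.norm_iteratedDeriv_le_of_forall_mem_sphere_norm_le k (by positivity)
      ((hφ.mono ((hball w hw).trans hδU)).diffContOnCl_ball subset_rfl)
      fun z hz => hM z (hball w hw (sphere_subset_closedBall hz))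
    have hk : (0 : ℝ) < k.factorial := by exact_mod_cast k.factorial_pos
    rw [norm_mul, norm_inv, Complex.norm_natCast]
    calc _ ≤ (k.factorial : ℝ)⁻¹ * (k.factorial * M / (2 * r) ^ k) := by gcongr
      _ = _ := by field_simp
  have ha_diff : ∀ k, ∀ w ∈ thickening (2 * r) (range f), DifferentiableAt ℂ (a k) w := by
    intro k w hw
    have hwU : U ∈ nhds w :=
      hU.mem_nhds (hδU (hball w hw (mem_closedBall_self (by positivity))))
    simp only [a, iteratedDeriv_eq_iterate]
    exact ((hφ.analyticAt hwU).iterated_deriv k).differentiableAt.const_mul _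
  have ha_sum : ∀ w ∈ thickening (2 * r) (range f), ∀ y ∈ ball w (2 * r),
      HasSum (fun k => (y - w) ^ k * a k w) (φ y) := by
    intro w hw y hy
    have h := Complex.hasSum_taylorSeries_on_ball
      (hφ.mono (ball_subset_closedBall.trans ((hball w hw).trans hδU))) hy
    convert! h using 2 with k
    simp only [a, smul_eq_mul]
    ring
  obtain ⟨s, hs⟩ := exists_wienerNorm_sub_le hν hf hr
  -- A Laurent polynomial extends off the circle, so every `a k ∘ p` is holomorphic on one annulus,
  -- with `ρ` independent of `k`.
  let p : ℂ → ℂ := fun z => ∑ n ∈ s, circleFourierCoeff f n * z ^ n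
  have hp : ∀ z : ℂ, z ≠ 0 → DifferentiableAt ℂ p z := fun z hz =>
    .fun_sum fun n _ => (differentiableAt_zpow.2 (Or.inl hz)).const_mul _
  have hpc : Continuous fun z : Circle => p z := continuous_iff_continuousAt.2 fun z =>
    (hp z (Circle.coe_ne_zero z)).continuousAt.comp continuous_subtype_val.continuousAt
  have he : HasACFS ν fun z => f z - p z :=
    hasACFS_of_wienerNorm_ne_top hν0 (hf.continuous.sub hpc) (hs.trans_lt ENNReal.ofReal_lt_top).ne
  have he_norm : ∀ z : Circle, ‖f z - p z‖ ≤ r := fun z => by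
    have h := (enorm_le_wienerNorm hν.one_le he z).trans hs
    rwa [← ofReal_norm, ENNReal.ofReal_le_ofReal_iff hr.le] at h
  have hV : IsOpen ({0}ᶜ ∩ p ⁻¹' thickening (2 * r) (range f)) :=
    ContinuousOn.isOpen_inter_preimage
      (fun z hz => (hp z hz).continuousAt.continuousWithinAt) isOpen_compl_singleton
      isOpen_thickening
  have hpmem : ∀ z : Circle, p z ∈ thickening (2 * r) (range f) := fun z =>
    mem_thickening_iff.2 ⟨f z, mem_range_self z, by
      rw [dist_comm, dist_eq_norm]
      linarith [he_norm z]⟩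
  obtain ⟨ρ, hρ, hρ1, hρV⟩ := exists_annulus_subset hV fun z hz =>
    ⟨fun h => by simp [mem_singleton_iff.1 h] at hz, hpmem ⟨z, hz⟩⟩
  have hak : ∀ k, Continuous fun z : Circle => a k (p z) := fun k =>
    continuous_iff_continuousAt.2 fun z =>
      ContinuousAt.comp (f := fun z : Circle => p z)
        (ha_diff k _ (hpmem z)).continuousAt hpc.continuousAt
  -- The growth hypothesis on `ν` enters here, against the decay `ρ ^ |n|` of the coefficients.
  have hak_norm : ∀ k, wienerNorm ν (fun z : Circle => a k (p z)) ≤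
      ENNReal.ofReal (M / (2 * r) ^ k * ∑' n : ℤ, ν n * ρ ^ n.natAbs) := by
    intro k
    have hsum := hsub ρ hρ hρ1
    rw [← tsum_mul_left, ENNReal.ofReal_tsum_of_nonneg
      (fun n => mul_nonneg (by positivity) (mul_nonneg (hν0 n) (by positivity)))
      (hsum.mul_left _)]
    refine ENNReal.tsum_le_tsum fun n => ?_
    rw [enorm_mul_ofReal_eq]
    refine ENNReal.ofReal_le_ofReal ?_
    have h := norm_circleFourierCoeff_le_of_annulus (h := fun z => a k (p z)) hρ hρ1.le
      (fun z h1 h2 => (ha_diff k _ (hρV z h1 h2).2).comp z (hp z (hρV z h1 h2).1))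
      (fun z h1 h2 => ha_bound k _ (hρV z h1 h2).2) n
    calc _ ≤ M / (2 * r) ^ k * ρ ^ n.natAbs * ν n := mul_le_mul_of_nonneg_right h (hν0 n)
      _ = _ := by ring
  have hhalf : ∀ k, r ^ k * (M / (2 * r) ^ k) = M * (1 / 2) ^ k := fun k => by
    rw [mul_pow, one_div, inv_pow]
    field_simp
  have hgeom : Summable fun k : ℕ => (1 / 2 : ℝ) ^ k := summable_geometric_two
  refine hasACFS_of_wienerNorm_ne_top hν0 hcont (ne_top_of_le_ne_top ?_ (wienerNorm_le_tsum ν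
    (g := fun (k : ℕ) z => (f z - p z) ^ k * a k (p z)) (u := fun k => M * (1 / 2) ^ k)
    (fun k => (he.continuous.pow k).mul (hak k)) (hgeom.mul_left M) (fun k z => ?_) fun z => ?_))
  · have hle : ∀ k, wienerNorm ν (fun z : Circle => (f z - p z) ^ k * a k (p z)) ≤
        ENNReal.ofReal (M * (1 / 2) ^ k * ∑' n : ℤ, ν n * ρ ^ n.natAbs) := by
      intro k
      refine (wienerNorm_pow_mul_le hν he (hak k) k).trans ?_
      rw [← hhalf, mul_assoc, ENNReal.ofReal_mul (by positivity), ENNReal.ofReal_pow hr.le]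
      exact mul_le_mul' (pow_le_pow_left' hs k) (hak_norm k)
    exact ne_top_of_le_ne_top ((hgeom.mul_left M).mul_right _).tsum_ofReal_ne_top
      (ENNReal.tsum_le_tsum hle)
  · rw [norm_mul, norm_pow, ← hhalf]
    gcongr
    · exact he_norm z
    · exact ha_bound k _ (hpmem z)
  · refine ha_sum _ (hpmem z) _ ?_
    rw [mem_ball, dist_eq_norm]
    linarith [he_norm z]

/-! ### The logarithmic weight and the theorem -/

/-- The weight `1 + log ω`. -/
theorem IsWeight.one_add_log {ω : ℤ → ℝ} (hω : IsWeight ω) :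
    IsWeight fun n => 1 + Real.log (ω n) := by
  have hlog : ∀ n, 0 ≤ Real.log (ω n) := fun n => Real.log_nonneg (hω.one_le n)
  have hpos : ∀ n, 0 < ω n := fun n => one_pos.trans_le (hω.one_le n)
  refine ⟨fun n => by linarith [hlog n], fun m n => ?_⟩
  have h := Real.log_le_log (hpos _) (hω.submul m n)
  rw [Real.log_mul (hpos m).ne' (hpos n).ne'] at h
  nlinarith [mul_nonneg (hlog m) (hlog n)]

theorem one_add_log_le {x : ℝ} (hx : 1 ≤ x) : 1 + Real.log x ≤ x := by
  linarith [Real.log_le_sub_one_of_pos (one_pos.trans_le hx)]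

theorem isConstantWeight_one_add_log_iff {ω : ℤ → ℝ} (hω : IsWeight ω) :
    IsConstantWeight (fun n => 1 + Real.log (ω n)) ↔ IsConstantWeight ω := by
  have hpos : ∀ n, 0 < ω n := fun n => one_pos.trans_le (hω.one_le n)
  constructor
  · rintro ⟨c, hc⟩
    refine ⟨Real.exp (c - 1), fun n => ?_⟩
    rw [← hc n, add_sub_cancel_left, Real.exp_log (hpos n)]
  · rintro ⟨c, hc⟩
    exact ⟨1 + Real.log c, fun n => by simp only [hc]⟩

/-- A weight grows at most exponentially. -/
theorem IsWeight.exists_le_pow {ω : ℤ → ℝ} (hω : IsWeight ω) :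
    ∃ C : ℝ, 1 ≤ C ∧ ∀ n : ℤ, ω n ≤ C ^ (n.natAbs + 1) := by
  -- `ω 0` may exceed `1`; including it, with the exponent `k + 1`, covers `k = 0`.
  let C := max (ω 0) (max (ω 1) (ω (-1)))
  have hC : 1 ≤ C := (hω.one_le 0).trans (le_max_left _ _)
  have step : ∀ e : ℤ, ω e ≤ C → ∀ k : ℕ, ω (k * e) ≤ C ^ (k + 1) := by
    intro e he k
    induction k with
    | zero => simp [C]
    | succ k ih =>
      rw [Nat.cast_succ, add_mul, one_mul, pow_succ]
      exact (hω.submul _ _).trans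
        (mul_le_mul ih he (zero_le_one.trans (hω.one_le _)) (by positivity))
  refine ⟨C, hC, fun n => ?_⟩
  rcases Int.natAbs_eq n with h | h
  · have h1 := step 1 ((le_max_left _ _).trans (le_max_right _ _)) n.natAbs
    rwa [mul_one, ← h] at h1
  · have h1 := step (-1) ((le_max_right _ _).trans (le_max_right _ _)) n.natAbs
    rwa [mul_neg_one, ← h] at h1

theorem IsWeight.summable_one_add_log_mul_pow {ω : ℤ → ℝ} (hω : IsWeight ω) {q : ℝ} (hq : 0 < q)
    (hq1 : q < 1) : Summable fun n : ℤ => (1 + Real.log (ω n)) * q ^ n.natAbs := by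
  obtain ⟨C, hC, hle⟩ := hω.exists_le_pow
  have hnat : Summable fun k : ℕ => (1 + (k + 1) * Real.log C) * q ^ k := by
    have h1 := summable_geometric_of_lt_one hq.le hq1
    have h2 := summable_pow_mul_geometric_of_norm_lt_one 1
      (show ‖q‖ < 1 by rwa [Real.norm_of_nonneg hq.le])
    convert! (h1.mul_left (1 + Real.log C)).add (h2.mul_left (Real.log C)) using 2
    ring
  have hint : Summable fun n : ℤ => (1 + (n.natAbs + 1) * Real.log C) * q ^ n.natAbs :=
    Summable.of_nat_of_neg (by simpa using hnat) (by simpa using hnat)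
  have hω1 := hω.one_add_log.one_le
  refine hint.of_nonneg_of_le
    (fun n => mul_nonneg (zero_le_one.trans (hω1 n)) (by positivity)) fun n => ?_
  have h := Real.log_le_log (one_pos.trans_le (hω.one_le n)) (hle n)
  rw [Real.log_pow, Nat.cast_succ] at h
  gcongr

theorem mainTheorem1 (ω : ℤ → ℝ) (hω : IsWeight ω) (f : Circle → ℂ) (hf : HasACFS ω f) :
    ((∀ z, f z ≠ 0) →
      ∃ ν : ℤ → ℝ, IsWeight ν ∧
        HasACFS ν (fun z => 1 / f z) ∧
        (¬ IsConstantWeight ν ↔ ¬ IsConstantWeight ω) ∧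
        (∀ n, ν n ≤ ω n)) ∧
    (∀ (U : Set ℂ) (φ : ℂ → ℂ), IsOpen U → Set.range f ⊆ U → DifferentiableOn ℂ φ U →
      ∃ χ : ℤ → ℝ, IsWeight χ ∧
        HasACFS χ (φ ∘ f) ∧
        (¬ IsConstantWeight χ ↔ ¬ IsConstantWeight ω) ∧
        (∀ n, χ n ≤ ω n)) := by
  have hν := hω.one_add_log
  have hνω : ∀ n, 1 + Real.log (ω n) ≤ ω n := fun n => one_add_log_le (hω.one_le n)
  have hfν := hf.mono (fun n => zero_le_one.trans (hν.one_le n)) hνω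
  have main : ∀ (U : Set ℂ) (φ : ℂ → ℂ), IsOpen U → Set.range f ⊆ U → DifferentiableOn ℂ φ U →
      HasACFS (fun n => 1 + Real.log (ω n)) (φ ∘ f) := fun U φ hU hfU hφ =>
    hfν.comp_of_subexponential hν (fun _ => hω.summable_one_add_log_mul_pow) hU hfU hφ
  have hconst := not_congr (isConstantWeight_one_add_log_iff hω)
  refine ⟨fun h0 => ⟨_, hν, ?_, hconst, hνω⟩,
    fun U φ hU hfU hφ => ⟨_, hν, main U φ hU hfU hφ, hconst, hνω⟩⟩
  refine main {0}ᶜ (fun w => 1 / w) isOpen_compl_singleton ?_ fun w hw => ?_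
  · rintro _ ⟨z, rfl⟩
    exact h0 z
  · exact ((differentiableAt_const (1 : ℂ)).div differentiableAt_fun_id hw).differentiableWithinAt
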